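/- Let $G$ be a group, $n\ge 0$, and let $X$ be a simplicial model of $K(G,1)$ with finite $(n+1)$-skeleton: a simplicial set $X=E/G$ where $E$ is a simplicial set with contractible geometric realization and a free simplicial action of $G$, such that $X$ has finitely many nondegenerate $i$-simplices, $k_i$ of them, for each $i\le n+1$. After a lift to $E$ of each nondegenerate simplex of $X$ of dimension at most $n+1$ is chosen, the codifferentials of the cochain complex of $G$ with coefficients in a representation are given by matrices $d_i\in\mathbb{M}_{k_{i+1}\times k_i}(\mathbb{R}G)$, $i\le n$: the $(\sigma,\tau)$ entry of $d_i$ is the sum of $(-1)^j g$ over all $j$ and $g\in G$ with $\partial_j\tilde\sigma=g\tilde\tau$. Put $k=k_n$, $d_{-1}=0$ (with zero source), $\Delta_n^+=d_n^*d_n$, $\Delta_n^-=d_{n-1}d_{n-1}^*$ and $\Delta_n=\Delta_n^++\Delta_n^-$. Let $\lambda$ be the left regular representation of $G$ on $\ell_2(G)$ and let $C^*_r(G)$ be the reduced group $C^*$-algebra, the norm closure of $\lambda(\mathbb{C}G)$; the matrices above are regarded as matrices over $C^*_r(G)$. Let $\beta^n_{(2)}(G)=\sum_{i=1}^{k}\langle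 P(\delta_e e_i),\delta_e e_i\rangle$ be the $n$-th $\ell_2$-Betti number, i.e. the von Neumann dimension of $\ker\lambda(\Delta_n)\subseteq \ell_2(G)^{k}$, where $P$ is the orthogonal projection of $\ell_2(G)^k$ onto $\ker\lambda(\Delta_n)$ and $\delta_e e_i$ is the vector with $i$-th coordinate $\delta_e$ and all other coordinates $0$. Assume $\beta^n_{(2)}(G)\neq 0$. (1) Suppose $0$ is isolated in the spectrum of $\Delta_n^+$ in $\mathbb{M}_k(C^*_r(G))$, i.e. for some $\varepsilon>0$ the spectrum contains no nonzero $z$ with $|z|<\varepsilon$. Then there is a unique projection $p_n^+\in\mathbb{M}_k(C^*_r(G))$ that acts on $\ell_2(G)^k$ as the orthogonal projection onto $\ker\lambda(d_n)$, and its class satisfies $[p_n^+]\neq 0$ in $K_0(C^*_r(G))$. (2) Suppose $0$ is isolated, in the same sense, in the spectrum of $\Delta_n^-$ in $\mathbb{M}_k(C^*_r(G))$. Then there is a unique projection $p_n^-\in\mathbb{M}_k(C^*_r(G))$ that acts on $\ell_2(G)^k$ as the orthogonal projection onto $\ker\lambda(d_{n-1}^*)$, and its class satisfies $[p_n^-]\neq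 0$ in $K_0(C^*_r(G))$. -/

import Mathlib

universe u w

namespace HigherKazhdan

noncomputable section

/-! ### `K₀` of a unital C⋆-algebra -/

section KTheory

variable {A : Type*} [Ring A] [StarRing A]

/-- Murray–von Neumann equivalence of two square matrices (possibly of different sizes): there is
a rectangular matrix `v` with `v⋆ v = p` and `v v⋆ = q`. -/
def MvNEquiv {m n : Type*} [Fintype m] [Fintype n] (p : Matrix m m A) (q : Matrix n n A) : Prop :=
  ∃ v : Matrix n m A, v.conjTranspose * v = p ∧ v * v.conjTranspose = q

lemma isStarProjection_reindex {m n : Type*} [Fintype m] [Fintype n] (e : m ≃ n)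
    {p : Matrix m m A} (hp : IsStarProjection p) : IsStarProjection (p.submatrix e.symm e.symm) := by
  refine ⟨?_, ?_⟩
  · have h : p * p = p := hp.isIdempotentElem
    simp [IsIdempotentElem, Matrix.submatrix_mul_equiv, h]
  · have h : p.conjTranspose = p := hp.isSelfAdjoint
    simp [IsSelfAdjoint, Matrix.star_eq_conjTranspose, h]

lemma mvNEquiv_reindex {m n : Type*} [Fintype m] [Fintype n] (e : m ≃ n)
    {p : Matrix m m A} (hp : IsStarProjection p) :
    MvNEquiv p (p.submatrix e.symm e.symm) := by
  have h1 : p * p = p := hp.isIdempotentElem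
  have h2 : p.conjTranspose = p := hp.isSelfAdjoint
  refine ⟨p.submatrix e.symm id, ?_, ?_⟩
  · rw [Matrix.conjTranspose_submatrix, h2, Matrix.submatrix_mul_equiv, h1, Matrix.submatrix_id_id]
  · have := Matrix.submatrix_mul_equiv p p e.symm (Equiv.refl m) e.symm
    rw [Matrix.conjTranspose_submatrix, h2]
    simpa [h1] using this

lemma MvNEquiv.refl {m : Type*} [Fintype m] {p : Matrix m m A} (hp : IsStarProjection p) :
    MvNEquiv p p := mvNEquiv_reindex (Equiv.refl m) hp

lemma MvNEquiv.symm {m n : Type*} [Fintype m] [Fintype n] {p : Matrix m m A} {q : Matrix n n A}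
    (h : MvNEquiv p q) : MvNEquiv q p := by
  obtain ⟨v, h1, h2⟩ := h
  exact ⟨v.conjTranspose, by simpa using h2, by simpa using h1⟩

lemma MvNEquiv.trans {l m n : Type*} [Fintype l] [Fintype m] [Fintype n]
    {p : Matrix l l A} {q : Matrix m m A} {r : Matrix n n A}
    (hp : IsStarProjection p) (hr : IsStarProjection r)
    (h : MvNEquiv p q) (h' : MvNEquiv q r) : MvNEquiv p r := by
  obtain ⟨v, h1, h2⟩ := h
  obtain ⟨u, h3, h4⟩ := h'
  have hpp : p * p = p := hp.isIdempotentElem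
  have hrr : r * r = r := hr.isIdempotentElem
  refine ⟨u * v, ?_, ?_⟩
  · calc (u * v).conjTranspose * (u * v)
        = v.conjTranspose * (u.conjTranspose * u) * v := by
          simp [Matrix.conjTranspose_mul, Matrix.mul_assoc]
      _ = (v.conjTranspose * v) * (v.conjTranspose * v) := by
          rw [h3, ← h2]; simp [Matrix.mul_assoc]
      _ = p := by rw [h1, hpp]
  · calc (u * v) * (u * v).conjTranspose
        = u * (v * v.conjTranspose) * u.conjTranspose := by
          simp [Matrix.conjTranspose_mul, Matrix.mul_assoc]
      _ = (u * u.conjTranspose) * (u * u.conjTranspose) := by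
          rw [h2, ← h3]; simp [Matrix.mul_assoc]
      _ = r := by rw [h4, hrr]

/-- The orthogonal direct sum of two square matrices. -/
def directSum {m n : Type*} (p : Matrix m m A) (q : Matrix n n A) : Matrix (m ⊕ n) (m ⊕ n) A :=
  Matrix.fromBlocks p 0 0 q

lemma isStarProjection_directSum {m n : Type*} [Fintype m] [Fintype n]
    {p : Matrix m m A} {q : Matrix n n A} (hp : IsStarProjection p) (hq : IsStarProjection q) :
    IsStarProjection (directSum p q) := by
  have h1 : p * p = p := hp.isIdempotentElem
  have h2 : p.conjTranspose = p := hp.isSelfAdjoint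
  have h3 : q * q = q := hq.isIdempotentElem
  have h4 : q.conjTranspose = q := hq.isSelfAdjoint
  refine ⟨?_, ?_⟩
  · simp [IsIdempotentElem, directSum, Matrix.fromBlocks_multiply, h1, h3]
  · simp [IsSelfAdjoint, Matrix.star_eq_conjTranspose, directSum,
      Matrix.fromBlocks_conjTranspose, h2, h4]

lemma MvNEquiv.directSum {m n m' n' : Type*} [Fintype m] [Fintype n] [Fintype m'] [Fintype n']
    {p : Matrix m m A} {q : Matrix n n A} {p' : Matrix m' m' A} {q' : Matrix n' n' A}
    (h : MvNEquiv p p') (h' : MvNEquiv q q') :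
    MvNEquiv (directSum p q) (directSum p' q') := by
  obtain ⟨v, h1, h2⟩ := h
  obtain ⟨u, h3, h4⟩ := h'
  refine ⟨Matrix.fromBlocks v 0 0 u, ?_, ?_⟩ <;>
    simp [HigherKazhdan.directSum, Matrix.fromBlocks_multiply, Matrix.fromBlocks_conjTranspose,
      h1, h2, h3, h4]

variable (A) in
/-- Projections in the matrix algebras `M_k(A)`, `k = 0, 1, 2, …`. -/
structure MatProj where
  size : ℕ
  val : Matrix (Fin size) (Fin size) A
  isProj : IsStarProjection val

/-- A projection indexed by a finite type, regarded as a projection in some `M_k(A)`. -/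
def MatProj.of {m : Type*} [Fintype m] (p : Matrix m m A) (hp : IsStarProjection p) :
    MatProj A where
  size := Fintype.card m
  val := p.submatrix (Fintype.equivFin m).symm (Fintype.equivFin m).symm
  isProj := isStarProjection_reindex (Fintype.equivFin m) hp

lemma MatProj.of_equiv {m : Type*} [Fintype m] (p : Matrix m m A) (hp : IsStarProjection p) :
    MvNEquiv p (MatProj.of p hp).val :=
  mvNEquiv_reindex (Fintype.equivFin m) hp

variable (A) in
/-- Murray–von Neumann equivalence on projections in matrix algebras over `A`. -/
instance matProjSetoid : Setoid (MatProj A) where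
  r p q := MvNEquiv p.val q.val
  iseqv :=
    { refl := fun p => MvNEquiv.refl p.isProj
      symm := fun h => h.symm
      trans := fun {p _ r} h h' => MvNEquiv.trans p.isProj r.isProj h h' }

variable (A) in
/-- The Murray–von Neumann semigroup `V(A)` of equivalence classes of projections. -/
def VSemigroup : Type _ := Quotient (matProjSetoid A)

/-- The class in `V(A)` of a projection in a matrix algebra. -/
def VSemigroup.mk {m : Type*} [Fintype m] (p : Matrix m m A) (hp : IsStarProjection p) :
    VSemigroup A :=
  Quotient.mk _ (MatProj.of p hp)

lemma VSemigroup.mk_eq_mk {m n : Type*} [Fintype m] [Fintype n] {p : Matrix m m A}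
    {q : Matrix n n A} (hp : IsStarProjection p) (hq : IsStarProjection q) :
    VSemigroup.mk p hp = VSemigroup.mk q hq ↔ MvNEquiv p q := by
  have hP := (MatProj.of p hp).isProj
  have hQ := (MatProj.of q hq).isProj
  constructor
  · intro h
    have h' : MvNEquiv (MatProj.of p hp).val (MatProj.of q hq).val := Quotient.exact h
    exact ((MatProj.of_equiv p hp).trans hp hQ h').trans hp hq (MatProj.of_equiv q hq).symm
  · intro h
    refine Quotient.sound ?_
    exact ((MatProj.of_equiv p hp).symm.trans hP hq h).trans hP hQ (MatProj.of_equiv q hq)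

lemma VSemigroup.exists_rep (x : VSemigroup A) :
    ∃ (k : ℕ) (p : Matrix (Fin k) (Fin k) A) (hp : IsStarProjection p),
      x = VSemigroup.mk p hp := by
  induction x using Quotient.inductionOn with
  | h p => exact ⟨p.size, p.val, p.isProj, Quotient.sound (MatProj.of_equiv p.val p.isProj)⟩

instance : Zero (VSemigroup A) :=
  ⟨VSemigroup.mk (0 : Matrix (Fin 0) (Fin 0) A) (.zero _)⟩

/-- Addition in `V(A)` is induced by the orthogonal direct sum of projections. -/
instance : Add (VSemigroup A) :=
  ⟨Quotient.map₂ (fun p q => MatProj.of (directSum p.val q.val)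
      (isStarProjection_directSum p.isProj q.isProj)) (by
    intro p p' h q q' h'
    have := (VSemigroup.mk_eq_mk (isStarProjection_directSum p.isProj q.isProj)
      (isStarProjection_directSum p'.isProj q'.isProj)).2 (MvNEquiv.directSum h h')
    exact Quotient.exact this)⟩

lemma VSemigroup.mk_add_mk {m n : Type*} [Fintype m] [Fintype n] {p : Matrix m m A}
    {q : Matrix n n A} (hp : IsStarProjection p) (hq : IsStarProjection q) :
    VSemigroup.mk p hp + VSemigroup.mk q hq =
      VSemigroup.mk (directSum p q) (isStarProjection_directSum hp hq) := by
  refine (VSemigroup.mk_eq_mk (isStarProjection_directSum (MatProj.of p hp).isProj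
    (MatProj.of q hq).isProj) (isStarProjection_directSum hp hq)).2 ?_
  exact MvNEquiv.directSum (MatProj.of_equiv p hp).symm (MatProj.of_equiv q hq).symm

instance : AddCommMonoid (VSemigroup A) where
  add_assoc x y z := by
    obtain ⟨k, p, hp, rfl⟩ := x.exists_rep
    obtain ⟨l, q, hq, rfl⟩ := y.exists_rep
    obtain ⟨m, r, hr, rfl⟩ := z.exists_rep
    simp only [VSemigroup.mk_add_mk]
    rw [VSemigroup.mk_eq_mk]
    convert mvNEquiv_reindex (Equiv.sumAssoc (Fin k) (Fin l) (Fin m))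
      (isStarProjection_directSum (isStarProjection_directSum hp hq) hr) using 1
    ext (i | i | i) (j | j | j) <;> simp [directSum]
  zero_add x := by
    obtain ⟨k, p, hp, rfl⟩ := x.exists_rep
    refine (VSemigroup.mk_add_mk _ hp).trans ((VSemigroup.mk_eq_mk _ _).2 ?_)
    convert mvNEquiv_reindex (Equiv.emptySum (Fin 0) (Fin k))
      (isStarProjection_directSum (.zero (Matrix (Fin 0) (Fin 0) A)) hp) using 1
    ext i j
    simp [directSum]
  add_zero x := by
    obtain ⟨k, p, hp, rfl⟩ := x.exists_rep
    refine (VSemigroup.mk_add_mk hp _).trans ((VSemigroup.mk_eq_mk _ _).2 ?_)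
    convert mvNEquiv_reindex (Equiv.sumEmpty (Fin k) (Fin 0))
      (isStarProjection_directSum hp (.zero (Matrix (Fin 0) (Fin 0) A))) using 1
    ext i j
    simp [directSum]
  add_comm x y := by
    obtain ⟨k, p, hp, rfl⟩ := x.exists_rep
    obtain ⟨l, q, hq, rfl⟩ := y.exists_rep
    simp only [VSemigroup.mk_add_mk]
    rw [VSemigroup.mk_eq_mk]
    convert mvNEquiv_reindex (Equiv.sumComm (Fin k) (Fin l))
      (isStarProjection_directSum hp hq) using 1
    ext (i | i) (j | j) <;> simp [directSum]
  nsmul := nsmulRec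

variable (A) in
/-- `K₀(A)` of a unital C⋆-algebra `A`: the Grothendieck group of `V(A)`. -/
abbrev K0 : Type _ := Algebra.GrothendieckAddGroup (VSemigroup A)

/-- The class `[p] ∈ K₀(A)` of a projection `p` in a matrix algebra over `A`. -/
def K0.classOf {m : Type*} [Fintype m] (p : Matrix m m A) (hp : IsStarProjection p) : K0 A :=
  Algebra.GrothendieckAddGroup.of (VSemigroup.mk p hp)

end KTheory

/-! ### The reduced group C⋆-algebra -/

section ReducedCStar

variable (G : Type u) [Group G]

/-- The Hilbert space `ℓ²(G)`. -/
abbrev EllTwo : Type u := lp (fun _ : G => ℂ) 2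

variable {G} in
lemma memℓp_translate (g : G) {ξ : G → ℂ} (hξ : Memℓp ξ 2) :
    Memℓp (fun h => ξ (g⁻¹ * h)) 2 := by
  have h2 : (0 : ℝ) < (2 : ENNReal).toReal := by norm_num
  rw [memℓp_gen_iff h2] at hξ ⊢
  exact (Equiv.mulLeft g⁻¹).summable_iff.2 hξ

/-- The left translation `(λ_g ξ)(h) = ξ(g⁻¹ h)` as a linear isometry of `ℓ²(G)`. -/
def translate (g : G) : EllTwo G →ₗᵢ[ℂ] EllTwo G where
  toFun ξ := ⟨fun h => ξ (g⁻¹ * h), memℓp_translate g (lp.memℓp ξ)⟩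
  map_add' _ _ := rfl
  map_smul' _ _ := rfl
  norm_map' ξ := by
    have h2 : (0 : ℝ) < (2 : ENNReal).toReal := by norm_num
    rw [lp.norm_eq_tsum_rpow h2, lp.norm_eq_tsum_rpow h2]
    congr 1
    exact (Equiv.mulLeft g⁻¹).tsum_eq (fun h => ‖ξ h‖ ^ (2 : ENNReal).toReal)

/-- The left regular representation of `G` on `ℓ²(G)`. -/
def leftRegular : G →* (EllTwo G →L[ℂ] EllTwo G) where
  toFun g := (translate G g).toContinuousLinearMap
  map_one' := by
    ext ξ h
    simp [translate]
  map_mul' g g' := by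
    ext ξ h
    change ξ ((g * g')⁻¹ * h) = ξ (g'⁻¹ * (g⁻¹ * h))
    rw [mul_inv_rev, mul_assoc]

/-- The reduced group C⋆-algebra: the norm closure in `B(ℓ²(G))` of the ⋆-algebra generated by the
left translations (which is the image of `ℂ[G]` under the left regular representation). -/
def reducedSubalgebra : StarSubalgebra ℂ (EllTwo G →L[ℂ] EllTwo G) :=
  (StarAlgebra.adjoin ℂ (Set.range (leftRegular G))).topologicalClosure

/-- `C⋆_r(G)` as a type. -/
abbrev ReducedCStar : Type u := reducedSubalgebra G

/-- The left regular representation with values in `C⋆_r(G)`. -/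
def leftRegularCStar : G →* ReducedCStar G :=
  (leftRegular G).codRestrict (reducedSubalgebra G) fun g =>
    StarSubalgebra.le_topologicalClosure _ (StarAlgebra.subset_adjoin ℂ _ ⟨g, rfl⟩)

/-- The inclusion of the real group ring into `C⋆_r(G)`. -/
def groupRingToCStar : MonoidAlgebra ℝ G →ₐ[ℝ] ReducedCStar G :=
  MonoidAlgebra.lift ℝ (ReducedCStar G) G (leftRegularCStar G)

variable {G}

/-- The operator `ℓ²(G)^n → ℓ²(G)^m` (Hilbert direct sums) given by an `m × n` matrix over
`C⋆_r(G)`. -/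
def matOp {m n : Type*} [Fintype m] [Fintype n] (a : Matrix m n (ReducedCStar G)) :
    PiLp 2 (fun _ : n => EllTwo G) →L[ℂ] PiLp 2 (fun _ : m => EllTwo G) :=
  ((PiLp.continuousLinearEquiv 2 ℂ (fun _ : m => EllTwo G)).symm :
      (m → EllTwo G) →L[ℂ] PiLp 2 (fun _ : m => EllTwo G)) ∘L
    ContinuousLinearMap.pi fun i => ∑ j,
      (a i j : EllTwo G →L[ℂ] EllTwo G) ∘L PiLp.proj 2 (fun _ : n => EllTwo G) j

open Classical in
/-- The von Neumann dimension of a closed subspace `K` of `ℓ²(G)^k` (meaningful if `K` is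
invariant under `G`): the sum over the diagonal of `⟨P_K δ_e, δ_e⟩`, where `P_K` is the orthogonal
projection onto `K`. -/
def vonNeumannDim {k : Type*} [Fintype k]
    (K : Submodule ℂ (PiLp 2 (fun _ : k => EllTwo G))) [K.HasOrthogonalProjection] : ℝ :=
  ∑ i, RCLike.re (inner ℂ
    (PiLp.single 2 i (lp.single 2 (1 : G) (1 : ℂ)) : PiLp 2 (fun _ : k => EllTwo G))
    (K.starProjection (PiLp.single 2 i (lp.single 2 (1 : G) (1 : ℂ)))))

end ReducedCStar

/-- The point `0` is isolated in (or not contained in) the spectrum of `a`. -/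
def ZeroIsolatedInSpectrum {A : Type*} [Ring A] [Algebra ℂ A] (a : A) : Prop :=
  ∃ ε : ℝ, 0 < ε ∧ ∀ z ∈ spectrum ℂ a, ‖z‖ < ε → z = 0

/-! ### Models of `K(G,1)` with finite skeleton -/

section Model

open CategoryTheory Simplicial Opposite

/-- A simplicial model `X` of `K(G,1)` with finite `N`-skeleton, given together with its universal
cover `E`: a simplicial set whose geometric realization is contractible, with a free (left)
simplicial action of `G` for which `E → X` is the quotient map. The
`m`-cells of the realization of `X` are its nondegenerate `m`-simplices. For `i ≤ N`,
`k i` is the number of these in `X`, and `cell i` lists one chosen lift to `E` of each of them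
(`k i` and `cell i` carry no information for `i > N`). -/
structure KG1Model (G : Type u) [Group G] (N : ℕ) where
  X : SSet.{w}
  E : SSet.{w}
  proj : E ⟶ X
  act : G → (E ⟶ E)
  act_one : act 1 = 𝟙 E
  act_mul : ∀ g h, act (g * h) = act h ≫ act g
  act_free : ∀ (m : ℕ) (x : E _⦋m⦌) (g : G), (act g).app (op ⦋m⦌) x = x → g = 1
  proj_surjective : ∀ (m : ℕ) (y : X _⦋m⦌), ∃ x : E _⦋m⦌, proj.app (op ⦋m⦌) x = y
  proj_eq_iff : ∀ (m : ℕ) (x y : E _⦋m⦌),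
    proj.app (op ⦋m⦌) x = proj.app (op ⦋m⦌) y ↔ ∃ g, (act g).app (op ⦋m⦌) y = x
  contractible : ContractibleSpace (SSet.toTop.obj E)
  k : ℕ → ℕ
  cell : ∀ i, Fin (k i) → E _⦋i⦌
  cell_bijOn : ∀ i ≤ N, Set.BijOn (fun j => proj.app (op ⦋i⦌) (cell i j)) Set.univ
    (X.nonDegenerate i)

namespace KG1Model

variable {G : Type u} [Group G] {N : ℕ} (M : KG1Model.{u, w} G N)

open Classical in
/-- The codifferential `d_n` as a `k_{n+1} × k_n` matrix over `ℝ[G]`. Its `(σ, τ)` entry is the sum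
of `(-1)^j g` over all faces of the form `∂_j σ = g τ`. (Faces that are degenerate do not
contribute: this is the normalized, i.e. cellular, cochain complex.) -/
def d (n : ℕ) : Matrix (Fin (M.k (n + 1))) (Fin (M.k n)) (MonoidAlgebra ℝ G) := fun σ τ =>
  ∑ j : Fin (n + 2),
    if h : ∃ g : G, M.E.δ j (M.cell (n + 1) σ) = (M.act g).app (op ⦋n⦌) (M.cell n τ) then
      MonoidAlgebra.single h.choose ((-1 : ℝ) ^ (j : ℕ))
    else 0

end KG1Model

end Model

namespace KG1Model

variable {G : Type u} [Group G] {N : ℕ} (M : KG1Model.{u, w} G N)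

/-- The number of `(n-1)`-simplices, which is `0` for `n = 0`. -/
def kPrev : ℕ → ℕ
  | 0 => 0
  | n + 1 => M.k n

/-- The codifferential `d_{n-1}`, from `(n-1)`-cochains to `n`-cochains; for `n = 0` its source is
the zero space. -/
def dPrev : (n : ℕ) → Matrix (Fin (M.k n)) (Fin (M.kPrev n)) (MonoidAlgebra ℝ G)
  | 0 => 0
  | n + 1 => M.d n

/-- `d_n` as a matrix over `C⋆_r(G)`. -/
def dRed (n : ℕ) : Matrix (Fin (M.k (n + 1))) (Fin (M.k n)) (ReducedCStar G) :=
  (M.d n).map (groupRingToCStar G)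

/-- `d_{n-1}` as a matrix over `C⋆_r(G)`. -/
def dPrevRed (n : ℕ) : Matrix (Fin (M.k n)) (Fin (M.kPrev n)) (ReducedCStar G) :=
  (M.dPrev n).map (groupRingToCStar G)

/-- `Δ_n^+ = d_n⋆ d_n` in `M_k(C⋆_r(G))`. -/
def lapPlus (n : ℕ) : Matrix (Fin (M.k n)) (Fin (M.k n)) (ReducedCStar G) :=
  (M.dRed n).conjTranspose * M.dRed n

/-- `Δ_n^- = d_{n-1} d_{n-1}⋆` in `M_k(C⋆_r(G))`. -/
def lapMinus (n : ℕ) : Matrix (Fin (M.k n)) (Fin (M.k n)) (ReducedCStar G) :=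
  M.dPrevRed n * (M.dPrevRed n).conjTranspose

/-- The Laplacian `Δ_n = Δ_n^+ + Δ_n^-` in `M_k(C⋆_r(G))`. -/
def lap (n : ℕ) : Matrix (Fin (M.k n)) (Fin (M.k n)) (ReducedCStar G) :=
  M.lapPlus n + M.lapMinus n

/-- The `n`-th `ℓ²`-Betti number: the von Neumann dimension of the kernel of the Laplacian. -/
def l2Betti (n : ℕ) : ℝ :=
  vonNeumannDim (matOp (M.lap n)).ker

/-- `p` is the partial Kazhdan projection `p_n^+`: a projection in `M_k(C⋆_r(G))` which acts on
`ℓ²(G)^k` as the orthogonal projection onto the kernel of `d_n`. -/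
def IsPartialKazhdanPlus (n : ℕ) (p : Matrix (Fin (M.k n)) (Fin (M.k n)) (ReducedCStar G)) :
    Prop :=
  IsStarProjection p ∧ (matOp p).range = (matOp (M.dRed n)).ker

/-- `p` is the partial Kazhdan projection `p_n^-`: a projection in `M_k(C⋆_r(G))` which acts on
`ℓ²(G)^k` as the orthogonal projection onto the kernel of `d_{n-1}⋆`. -/
def IsPartialKazhdanMinus (n : ℕ) (p : Matrix (Fin (M.k n)) (Fin (M.k n)) (ReducedCStar G)) :
    Prop :=
  IsStarProjection p ∧ (matOp p).range = (matOp (M.dPrevRed n).conjTranspose).ker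

end KG1Model

end

end HigherKazhdan

/-!
The statement holds for an arbitrary rectangular matrix `D` over `C⋆_r(G)` in place of `d_n` or
`d_{n-1}⋆`. If `0` is isolated in the spectrum of `a = D⋆ D`, then the indicator function of `{0}` is
continuous on this spectrum, and the continuous functional calculus of the C⋆-algebra
`M_k(C⋆_r(G))` turns it into a projection `p` with `a p = 0`. As `1 - p = g a` for some `g`, it acts on
`ℓ²(G)^k` as the orthogonal projection onto `ker a = ker D`
(`exists_isStarProjection_range_eq_ker`). Since matrices over `C⋆_r(G)` act faithfully and a
projection is determined by its range, `p` is unique (`eq_of_range_matOp_eq`).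

The functional `τ(a) = ⟨δ_e, a δ_e⟩` is a trace on `C⋆_r(G)`: by density of the group ring it suffices
to check `τ(ab) = τ(ba)` on left translations (`vecTrace_mul_comm`). Hence `p ↦ ∑ τ(p_ii)` is invariant
under Murray–von Neumann equivalence and induces a homomorphism `K₀(C⋆_r(G)) → ℂ`, whose value at the
kernel projection is the von Neumann dimension of `ker D` (`vonNeumannDim_eq_re_matTrace`).

Finally `ker Δ_n` is contained in both `ker d_n` and `ker d_{n-1}⋆` (`KG1Model.ker_lap_le`), and the
von Neumann dimension is nonnegative and monotone. A nonzero `ℓ²`-Betti number therefore makes the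
trace of either projection positive.
-/

namespace HigherKazhdan

noncomputable section

/-! ### Spectral projections at an isolated point of the spectrum -/

/-- If `0` is isolated in the spectrum of a self-adjoint `a`, the indicator function of `{0}` and
the function `z ↦ z⁻¹` (with `0⁻¹ = 0`) are continuous on the spectrum; they give the kernel
projection `p` of `a` and a quasi-inverse `g`. -/
lemma exists_isStarProjection_of_zeroIsolatedInSpectrum {B : Type*} [CStarAlgebra B] {a : B}
    (ha : IsSelfAdjoint a) (h0 : ZeroIsolatedInSpectrum a) :
    ∃ p g : B, IsStarProjection p ∧ a * p = 0 ∧ p + g * a = 1 := by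
  have hn : IsStarNormal a := ha.isStarNormal
  obtain ⟨ε, hε, hsp⟩ := h0
  -- `0` is an isolated point, so continuity there is automatic
  have key : ∀ f : ℂ → ℂ, (∀ z ≠ 0, ContinuousAt f z) → ContinuousOn f (spectrum ℂ a) := by
    intro f hf z hz
    by_cases h : z = 0
    · subst h
      have : f =ᶠ[nhdsWithin 0 (spectrum ℂ a)] fun _ => f 0 := by
        filter_upwards [self_mem_nhdsWithin,
          mem_nhdsWithin_of_mem_nhds (Metric.ball_mem_nhds (0 : ℂ) hε)] with w hw hw'
        rw [hsp w hw (by simpa using hw')]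
      exact continuousWithinAt_const.congr_of_eventuallyEq this rfl
    · exact (hf z h).continuousWithinAt
  have hinv : ContinuousOn (fun z : ℂ => z⁻¹) (spectrum ℂ a) :=
    key _ fun z hz => continuousAt_inv₀ hz
  have hind : ContinuousOn (fun z : ℂ => if z = 0 then (1 : ℂ) else 0) (spectrum ℂ a) := by
    refine key _ fun z hz => ?_
    refine (continuousAt_const (y := (0 : ℂ))).congr ?_
    filter_upwards [isOpen_ne.mem_nhds hz] with w hw
    rw [if_neg hw]
  refine ⟨cfc (fun z : ℂ => if z = 0 then (1 : ℂ) else 0) a, cfc (fun z : ℂ => z⁻¹) a,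
    ⟨?_, ?_⟩, ?_, ?_⟩
  · rw [IsIdempotentElem, ← cfc_mul _ _ a hind hind]
    congr 1
    ext z
    simp
  · rw [IsSelfAdjoint, ← cfc_star]
    congr 1
    ext z
    split_ifs <;> simp
  · nth_rewrite 1 [← cfc_id' ℂ a]
    rw [← cfc_mul _ _ a (continuousOn_id' _) hind, ← cfc_zero (R := ℂ) (a := a)]
    congr 1
    ext z
    simp
  · have hmul : ContinuousOn (fun z : ℂ => z⁻¹ * z) (spectrum ℂ a) :=
      hinv.mul (continuousOn_id' _)
    nth_rewrite 3 [← cfc_id' ℂ a]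
    rw [← cfc_mul _ _ a hinv (continuousOn_id' _), ← cfc_add _ _ _ hind hmul,
      ← cfc_one (R := ℂ) (a := a)]
    congr 1
    ext z
    by_cases h : z = 0 <;> simp [h]

section Reduced

variable {G : Type u} [Group G]

instance : CompleteSpace (ReducedCStar G) :=
  (StarSubalgebra.isClosed_topologicalClosure _).completeSpace_coe

instance : CStarAlgebra (ReducedCStar G) where

/-- The kernel projection in `M_m(C⋆_r(G))`, for which the norm of `CStarMatrix` makes the functional
calculus available. -/
lemma exists_isStarProjection_matrix {m : Type*} [Fintype m] [DecidableEq m]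
    {a : Matrix m m (ReducedCStar G)}
    (ha : a.conjTranspose = a) (h0 : ZeroIsolatedInSpectrum a) :
    ∃ p g : Matrix m m (ReducedCStar G), IsStarProjection p ∧ a * p = 0 ∧ p + g * a = 1 := by
  let _ : PartialOrder (ReducedCStar G) := CStarAlgebra.spectralOrder _
  have _ : StarOrderedRing (ReducedCStar G) := CStarAlgebra.spectralOrderedRing _
  let e : Matrix m m (ReducedCStar G) ≃⋆ₐ[ℂ] CStarMatrix m m (ReducedCStar G) :=
    CStarMatrix.ofMatrixStarAlgEquiv
  have ha' : IsSelfAdjoint (e a) := by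
    rw [IsSelfAdjoint, ← map_star, Matrix.star_eq_conjTranspose, ha]
  have h0' : ZeroIsolatedInSpectrum (e a) := by
    obtain ⟨ε, hε, h⟩ := h0
    refine ⟨ε, hε, ?_⟩
    rwa [AlgEquiv.spectrum_eq e a]
  obtain ⟨p, g, hp, h1, h2⟩ := exists_isStarProjection_of_zeroIsolatedInSpectrum ha' h0'
  refine ⟨e.symm p, e.symm g, hp.map e.symm, ?_, ?_⟩
  · simpa using congrArg e.symm h1
  · simpa using congrArg e.symm h2

/-! ### Matrices over the reduced group C⋆-algebra as operators -/

variable {l m n : Type*} [Fintype l] [Fintype m] [Fintype n]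

lemma matOp_apply (a : Matrix m n (ReducedCStar G)) (x : PiLp 2 fun _ : n => EllTwo G) (i : m) :
    matOp a x i = ∑ j, (a i j : EllTwo G →L[ℂ] EllTwo G) (x j) := by
  simp [matOp]

lemma matOp_mul (a : Matrix l m (ReducedCStar G)) (b : Matrix m n (ReducedCStar G)) :
    matOp (a * b) = matOp a ∘L matOp b := by
  ext1 x
  refine PiLp.ext fun i => ?_
  simp only [ContinuousLinearMap.comp_apply, matOp_apply, Matrix.mul_apply, map_sum]
  rw [Finset.sum_comm]
  refine Finset.sum_congr rfl fun j _ => ?_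
  simp

lemma matOp_add (a b : Matrix m n (ReducedCStar G)) : matOp (a + b) = matOp a + matOp b := by
  ext1 x
  refine PiLp.ext fun i => ?_
  simp [matOp_apply, Finset.sum_add_distrib]

lemma matOp_one [DecidableEq m] : matOp (1 : Matrix m m (ReducedCStar G)) = 1 := by
  ext1 x
  refine PiLp.ext fun i => ?_
  rw [matOp_apply, Finset.sum_eq_single i]
  · simp
  · intro j _ hj
    simp [Matrix.one_apply_ne hj.symm]
  · simp

lemma matOp_zero : matOp (0 : Matrix m n (ReducedCStar G)) = 0 := by
  ext1 x
  refine PiLp.ext fun i => ?_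
  simp [matOp_apply]

lemma matOp_single [DecidableEq n] (a : Matrix m n (ReducedCStar G)) (j : n) (ξ : EllTwo G)
    (i : m) : matOp a (PiLp.single 2 j ξ) i = (a i j : EllTwo G →L[ℂ] EllTwo G) ξ := by
  rw [matOp_apply, Finset.sum_eq_single j]
  · simp
  · intro k _ hk
    simp [hk]
  · simp

lemma matOp_injective :
    Function.Injective (matOp : Matrix m n (ReducedCStar G) → _) := by
  classical
  intro a b h
  ext i j : 2
  ext1 ξ
  rw [← matOp_single, ← matOp_single, h]

lemma inner_matOp_conjTranspose (a : Matrix m n (ReducedCStar G))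
    (x : PiLp 2 fun _ : m => EllTwo G) (y : PiLp 2 fun _ : n => EllTwo G) :
    inner ℂ (matOp a.conjTranspose x) y = inner ℂ x (matOp a y) := by
  simp only [PiLp.inner_apply, matOp_apply, sum_inner, inner_sum]
  rw [Finset.sum_comm]
  refine Finset.sum_congr rfl fun i _ => Finset.sum_congr rfl fun j _ => ?_
  exact ContinuousLinearMap.adjoint_inner_left _ _ _

lemma inner_matOp_conjTranspose_mul_self (a : Matrix m n (ReducedCStar G))
    (x : PiLp 2 fun _ : n => EllTwo G) :
    inner ℂ (matOp (a.conjTranspose * a) x) x = ((‖matOp a x‖ ^ 2 : ℝ) : ℂ) := by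
  rw [matOp_mul, ContinuousLinearMap.comp_apply, inner_matOp_conjTranspose,
    inner_self_eq_norm_sq_to_K]
  simp

lemma ker_matOp_conjTranspose_mul_self (a : Matrix m n (ReducedCStar G)) :
    (matOp (a.conjTranspose * a)).ker = (matOp a).ker := by
  ext x
  simp only [LinearMap.mem_ker, ContinuousLinearMap.coe_coe]
  constructor
  · intro h
    have h' := inner_matOp_conjTranspose_mul_self a x
    rw [h, inner_zero_left, eq_comm, Complex.ofReal_eq_zero] at h'
    simpa using h'
  · intro h
    rw [matOp_mul, ContinuousLinearMap.comp_apply, h, map_zero]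

lemma matOp_eq_self_of_mem_range {p : Matrix m m (ReducedCStar G)} (hp : IsStarProjection p)
    {x : PiLp 2 fun _ : m => EllTwo G} (hx : x ∈ (matOp p).range) : matOp p x = x := by
  obtain ⟨y, rfl⟩ := hx
  have h : p * p = p := hp.isIdempotentElem
  change (matOp p ∘L matOp p) y = matOp p y
  rw [← matOp_mul, h]

lemma matOp_eq_starProjection {p : Matrix m m (ReducedCStar G)} (hp : IsStarProjection p)
    (K : Submodule ℂ (PiLp 2 fun _ : m => EllTwo G)) [K.HasOrthogonalProjection]
    (hK : (matOp p).range = K) (x : PiLp 2 fun _ : m => EllTwo G) :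
    K.starProjection x = matOp p x := by
  have hs : p.conjTranspose = p := hp.isSelfAdjoint
  refine Submodule.eq_starProjection_of_mem_of_inner_eq_zero ?_ fun w hw => ?_
  · rw [← hK]
    exact ⟨x, rfl⟩
  · rw [← hK] at hw
    have hw' := matOp_eq_self_of_mem_range hp hw
    rw [inner_sub_left, sub_eq_zero, ← hs, inner_matOp_conjTranspose, hw']

lemma eq_of_range_matOp_eq {p q : Matrix m m (ReducedCStar G)} (hp : IsStarProjection p)
    (hq : IsStarProjection q) (h : (matOp q).range = (matOp p).range) : q = p := by
  have aux : ∀ {p q : Matrix m m (ReducedCStar G)}, IsStarProjection q →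
      (matOp q).range = (matOp p).range → q * p = p := fun {p q} hq h => by
    apply matOp_injective
    ext1 x
    rw [matOp_mul]
    exact matOp_eq_self_of_mem_range hq (h ▸ ⟨x, rfl⟩)
  have h1 : p.conjTranspose = p := hp.isSelfAdjoint
  have h2 : q.conjTranspose = q := hq.isSelfAdjoint
  calc q = (p * q).conjTranspose := by rw [aux hp h.symm, h2]
    _ = q * p := by rw [Matrix.conjTranspose_mul, h1, h2]
    _ = p := aux hq h

/-- If `0` is isolated in the spectrum of `D⋆ D`, then the orthogonal projection onto `ker D` is
given by a matrix over `C⋆_r(G)`. -/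
lemma exists_isStarProjection_range_eq_ker (D : Matrix m n (ReducedCStar G)) [DecidableEq n]
    (h0 : ZeroIsolatedInSpectrum (D.conjTranspose * D)) :
    ∃ p : Matrix n n (ReducedCStar G), IsStarProjection p ∧ (matOp p).range = (matOp D).ker := by
  obtain ⟨p, g, hp, h1, h2⟩ := exists_isStarProjection_matrix (by simp) h0
  refine ⟨p, hp, ?_⟩
  rw [← ker_matOp_conjTranspose_mul_self]
  ext x
  simp only [LinearMap.mem_ker, ContinuousLinearMap.coe_coe]
  constructor
  · rintro ⟨y, rfl⟩
    change (matOp _ ∘L matOp p) y = 0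
    rw [← matOp_mul, h1, matOp_zero, zero_apply]
  · intro hx
    have h3 := congrArg (fun b => matOp b x) h2
    simp only [matOp_add, matOp_one, add_apply] at h3
    rw [matOp_mul g, ContinuousLinearMap.comp_apply, hx, map_zero, add_zero] at h3
    exact ⟨x, h3⟩

/-! ### The canonical trace -/

open Classical in
variable (G) in
/-- The unit vector `δ_e` of `ℓ²(G)`. -/
def deltaOne : EllTwo G := lp.single 2 (1 : G) (1 : ℂ)

variable (G) in
/-- The vector functional `a ↦ ⟨δ_e, a δ_e⟩` on `B(ℓ²(G))`; its restriction to `C⋆_r(G)` is the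
canonical trace. -/
def vecTrace : (EllTwo G →L[ℂ] EllTwo G) →L[ℂ] ℂ :=
  innerSL ℂ (deltaOne G) ∘L ContinuousLinearMap.apply ℂ (EllTwo G) (deltaOne G)

lemma vecTrace_apply (a : EllTwo G →L[ℂ] EllTwo G) :
    vecTrace G a = inner ℂ (deltaOne G) (a (deltaOne G)) := rfl

open Classical in
lemma vecTrace_leftRegular (g : G) :
    vecTrace G (leftRegular G g) = if g = 1 then 1 else 0 := by
  rw [vecTrace_apply, deltaOne, lp.inner_single_left]
  change inner ℂ (1 : ℂ) (lp.single (E := fun _ : G => ℂ) 2 (1 : G) (1 : ℂ) (g⁻¹ * 1)) = _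
  rw [lp.single_apply]
  by_cases h : g = 1
  · subst h
    simp
  · simp [h]

lemma adjoint_leftRegular (g : G) : star (leftRegular G g) = leftRegular G g⁻¹ := by
  rw [ContinuousLinearMap.star_eq_adjoint, eq_comm, ContinuousLinearMap.eq_adjoint_iff]
  intro ξ η
  have h : leftRegular G g (leftRegular G g⁻¹ ξ) = ξ := by
    rw [← mul_apply_eq_comp, ← map_mul, mul_inv_cancel, map_one,
      one_apply_eq_self]
  conv_rhs => rw [← h]
  exact ((translate G g).inner_map_map _ _).symm

/-- `C⋆_r(G)` is contained in the closed linear span of the left translations. -/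
lemma reducedSubalgebra_subset_of_isClosed (W : Submodule ℂ (EllTwo G →L[ℂ] EllTwo G))
    (hW : IsClosed (W : Set (EllTwo G →L[ℂ] EllTwo G))) (h : ∀ g, leftRegular G g ∈ W)
    {a : EllTwo G →L[ℂ] EllTwo G} (ha : a ∈ reducedSubalgebra G) : a ∈ W := by
  have hstar : star (Set.range (leftRegular G)) = Set.range (leftRegular G) := by
    ext b
    constructor
    · rintro ⟨g, hg⟩
      exact ⟨g⁻¹, by rw [← adjoint_leftRegular, hg, star_star]⟩
    · rintro ⟨g, rfl⟩
      exact ⟨g⁻¹, (adjoint_leftRegular g).symm⟩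
  have hsub : (StarAlgebra.adjoin ℂ (Set.range (leftRegular G)) :
      Set (EllTwo G →L[ℂ] EllTwo G)) ⊆ W := by
    intro b hb
    have hb' : b ∈ Subalgebra.toSubmodule (Algebra.adjoin ℂ (Set.range (leftRegular G))) := by
      have hb2 : b ∈ (StarAlgebra.adjoin ℂ (Set.range (leftRegular G))).toSubalgebra := hb
      rwa [StarAlgebra.adjoin_toSubalgebra, hstar, Set.union_self] at hb2
    rw [Algebra.adjoin_eq_span, ← MonoidHom.coe_mrange, Submonoid.closure_eq] at hb'
    refine Submodule.span_le.2 ?_ hb'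
    rintro _ ⟨g, rfl⟩
    exact h g
  exact closure_minimal hsub hW ha

/-- Both sides are continuous and linear in each variable, so it suffices to compare them on the
left translations. -/
lemma vecTrace_mul_comm {a b : EllTwo G →L[ℂ] EllTwo G} (ha : a ∈ reducedSubalgebra G)
    (hb : b ∈ reducedSubalgebra G) : vecTrace G (a * b) = vecTrace G (b * a) := by
  let L := ContinuousLinearMap.mul ℂ (EllTwo G →L[ℂ] EllTwo G)
  have step : ∀ c, (∀ g, vecTrace G (c * leftRegular G g) = vecTrace G (leftRegular G g * c)) →
      ∀ {b}, b ∈ reducedSubalgebra G → vecTrace G (c * b) = vecTrace G (b * c) := by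
    intro c hc b hb
    have := reducedSubalgebra_subset_of_isClosed (vecTrace G ∘L (L c - L.flip c)).ker
      (ContinuousLinearMap.isClosed_ker _) (fun g => by simp [L, hc g]) hb
    simpa [L, sub_eq_zero] using this
  refine step a (fun g => (step (leftRegular G g) (fun h => ?_) ha).symm) hb
  rw [← map_mul, ← map_mul, vecTrace_leftRegular, vecTrace_leftRegular]
  classical exact if_congr mul_eq_one_comm rfl rfl

/-- The trace of a square matrix over `C⋆_r(G)`. -/
def matTrace (p : Matrix m m (ReducedCStar G)) : ℂ :=
  ∑ i, vecTrace G (p i i : EllTwo G →L[ℂ] EllTwo G)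

lemma matTrace_mul_comm (a : Matrix m n (ReducedCStar G)) (b : Matrix n m (ReducedCStar G)) :
    matTrace (a * b) = matTrace (b * a) := by
  simp only [matTrace, Matrix.mul_apply, AddSubmonoidClass.coe_finsetSum, map_sum,
    MulMemClass.coe_mul]
  rw [Finset.sum_comm]
  exact Finset.sum_congr rfl fun i _ => Finset.sum_congr rfl fun j _ =>
    vecTrace_mul_comm (SetLike.coe_mem _) (SetLike.coe_mem _)

lemma MvNEquiv.matTrace_eq {p : Matrix m m (ReducedCStar G)} {q : Matrix n n (ReducedCStar G)}
    (h : MvNEquiv p q) : matTrace p = matTrace q := by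
  obtain ⟨v, rfl, rfl⟩ := h
  exact matTrace_mul_comm _ _

lemma matTrace_directSum (p : Matrix m m (ReducedCStar G)) (q : Matrix n n (ReducedCStar G)) :
    matTrace (directSum p q) = matTrace p + matTrace q := by
  simp [matTrace, directSum]

variable (G) in
/-- The trace as an additive map on the Murray–von Neumann semigroup. -/
def vSemigroupTrace : VSemigroup (ReducedCStar G) →+ ℂ where
  toFun := Quotient.lift (fun p => matTrace p.val) fun _ _ h => MvNEquiv.matTrace_eq h
  map_zero' := by
    refine (MvNEquiv.matTrace_eq (MatProj.of_equiv (A := ReducedCStar G)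
      (0 : Matrix (Fin 0) (Fin 0) _) (.zero _))).symm.trans ?_
    simp [matTrace]
  map_add' x y := by
    induction x, y using Quotient.inductionOn₂ with
    | h p q =>
      refine (MvNEquiv.matTrace_eq (MatProj.of_equiv (directSum p.val q.val)
        (isStarProjection_directSum p.isProj q.isProj))).symm.trans ?_
      exact matTrace_directSum _ _

lemma vSemigroupTrace_mk {p : Matrix m m (ReducedCStar G)} (hp : IsStarProjection p) :
    vSemigroupTrace G (VSemigroup.mk p hp) = matTrace p :=
  (MvNEquiv.matTrace_eq (MatProj.of_equiv p hp)).symm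

/-- The trace factors through `K₀`. -/
lemma classOf_ne_zero {p : Matrix m m (ReducedCStar G)} (hp : IsStarProjection p)
    (h : matTrace p ≠ 0) : K0.classOf p hp ≠ 0 := by
  intro h0
  apply h
  have h1 := DFunLike.congr_fun
    (Algebra.GrothendieckAddGroup.lift.symm_apply_apply (vSemigroupTrace G)) (VSemigroup.mk p hp)
  rw [← vSemigroupTrace_mk hp, ← h1]
  change Algebra.GrothendieckAddGroup.lift (vSemigroupTrace G) (K0.classOf p hp) = 0
  rw [h0, map_zero]

/-! ### Von Neumann dimension -/

lemma vonNeumannDim_eq_re_matTrace {p : Matrix m m (ReducedCStar G)} (hp : IsStarProjection p)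
    (K : Submodule ℂ (PiLp 2 fun _ : m => EllTwo G)) [K.HasOrthogonalProjection]
    (hK : (matOp p).range = K) : vonNeumannDim K = (matTrace p).re := by
  classical
  rw [matTrace, Complex.re_sum, vonNeumannDim]
  refine Finset.sum_congr rfl fun i _ => ?_
  rw [matOp_eq_starProjection hp K hK, PiLp.inner_apply, Finset.sum_eq_single i]
  · rw [matOp_single, vecTrace_apply]
    simp [deltaOne]
  · intro j _ hj
    simp [hj]
  · simp

lemma vonNeumannDim_eq_sum_norm_sq [DecidableEq m] (K : Submodule ℂ (PiLp 2 fun _ : m => EllTwo G))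
    [K.HasOrthogonalProjection] :
    vonNeumannDim K = ∑ i, ‖K.starProjection (PiLp.single 2 i (deltaOne G))‖ ^ 2 := by
  rw [vonNeumannDim]
  refine Finset.sum_congr rfl fun i _ => ?_
  rw [← Submodule.inner_starProjection_left_eq_right, Submodule.re_inner_starProjection_eq_normSq]
  rw [← Submodule.coe_orthogonalProjectionOnto_apply, Submodule.coe_norm]
  simp only [deltaOne]
  congr!

lemma vonNeumannDim_nonneg (K : Submodule ℂ (PiLp 2 fun _ : m => EllTwo G))
    [K.HasOrthogonalProjection] : 0 ≤ vonNeumannDim K := by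
  classical
  rw [vonNeumannDim_eq_sum_norm_sq]
  positivity

lemma vonNeumannDim_mono {K L : Submodule ℂ (PiLp 2 fun _ : m => EllTwo G)}
    [K.HasOrthogonalProjection] [L.HasOrthogonalProjection] (h : K ≤ L) :
    vonNeumannDim K ≤ vonNeumannDim L := by
  classical
  rw [vonNeumannDim_eq_sum_norm_sq, vonNeumannDim_eq_sum_norm_sq]
  refine Finset.sum_le_sum fun i _ => ?_
  gcongr
  rw [← Submodule.starProjection_comp_starProjection_of_le h]
  exact K.norm_starProjection_apply_le _

/-- A closed subspace of `ker D` of nonzero von Neumann dimension forces the kernel projection of `D`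
to have positive trace, hence a nonzero class. -/
lemma exists_kernelProjection_classOf_ne_zero [DecidableEq n] (D : Matrix m n (ReducedCStar G))
    (K : Submodule ℂ (PiLp 2 fun _ : n => EllTwo G)) [K.HasOrthogonalProjection]
    (hK : vonNeumannDim K ≠ 0) (hKD : K ≤ (matOp D).ker)
    (h0 : ZeroIsolatedInSpectrum (D.conjTranspose * D)) :
    ∃ p, ∃ hp : IsStarProjection p ∧ (matOp p).range = (matOp D).ker,
      (∀ q, IsStarProjection q ∧ (matOp q).range = (matOp D).ker → q = p) ∧
        K0.classOf p hp.1 ≠ 0 := by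
  obtain ⟨p, hp, hr⟩ := exists_isStarProjection_range_eq_ker D h0
  refine ⟨p, ⟨hp, hr⟩, fun q hq => eq_of_range_matOp_eq hp hq.1 (hq.2.trans hr.symm),
    classOf_ne_zero hp fun htr => ?_⟩
  have h1 := vonNeumannDim_eq_re_matTrace hp _ hr
  have h2 := vonNeumannDim_mono hKD
  have h3 := (vonNeumannDim_nonneg K).lt_of_ne' hK
  rw [h1, htr, Complex.zero_re] at h2
  exact h2.not_gt h3

/-- `⟨(a⋆a + b⋆b) x, x⟩ = ‖a x‖² + ‖b x‖²`. -/
lemma ker_matOp_add_le (a : Matrix l n (ReducedCStar G)) (b : Matrix m n (ReducedCStar G)) :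
    (matOp (a.conjTranspose * a + b.conjTranspose * b)).ker ≤ (matOp a).ker ⊓ (matOp b).ker := by
  intro x hx
  have hx' : matOp (a.conjTranspose * a + b.conjTranspose * b) x = 0 := hx
  have h1 : inner ℂ (matOp (a.conjTranspose * a) x) x +
      inner ℂ (matOp (b.conjTranspose * b) x) x = (0 : ℂ) := by
    rw [← inner_add_left, ← add_apply, ← matOp_add, hx', inner_zero_left]
  rw [inner_matOp_conjTranspose_mul_self, inner_matOp_conjTranspose_mul_self,
    ← Complex.ofReal_add, Complex.ofReal_eq_zero,
    add_eq_zero_iff_of_nonneg (by positivity) (by positivity)] at h1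
  simpa [Submodule.mem_inf] using h1

end Reduced

lemma KG1Model.ker_lap_le {G : Type u} [Group G] {N : ℕ} (M : KG1Model.{u, w} G N) (n : ℕ) :
    (matOp (M.lap n)).ker ≤
      (matOp (M.dRed n)).ker ⊓ (matOp (M.dPrevRed n).conjTranspose).ker := by
  have := ker_matOp_add_le (M.dRed n) (M.dPrevRed n).conjTranspose
  rwa [Matrix.conjTranspose_conjTranspose] at this

end

end HigherKazhdan

theorem mainTheorem5 {G : Type u} [Group G] (n : ℕ)
    (M : HigherKazhdan.KG1Model.{u, w} G (n + 1)) (hβ : M.l2Betti n ≠ 0) :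
    (HigherKazhdan.ZeroIsolatedInSpectrum (M.lapPlus n) →
      ∃ p, ∃ hp : M.IsPartialKazhdanPlus n p,
        (∀ q, M.IsPartialKazhdanPlus n q → q = p) ∧ HigherKazhdan.K0.classOf p hp.1 ≠ 0) ∧
    (HigherKazhdan.ZeroIsolatedInSpectrum (M.lapMinus n) →
      ∃ p, ∃ hp : M.IsPartialKazhdanMinus n p,
        (∀ q, M.IsPartialKazhdanMinus n q → q = p) ∧ HigherKazhdan.K0.classOf p hp.1 ≠ 0) := by
  refine ⟨fun h0 => ?_, fun h0 => ?_⟩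
  · exact HigherKazhdan.exists_kernelProjection_classOf_ne_zero (M.dRed n) _ hβ
      ((M.ker_lap_le n).trans inf_le_left) h0
  · refine HigherKazhdan.exists_kernelProjection_classOf_ne_zero (M.dPrevRed n).conjTranspose _ hβ
      ((M.ker_lap_le n).trans inf_le_right) ?_
    rwa [Matrix.conjTranspose_conjTranspose]
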